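/- Let $R$ be an integral domain with quotient field $K$, and let ${\rm Int}(R)=\{f\in K[X] : f(R)\subseteq R\}$ be the ring of integer-valued polynomials over $R$. If $R$ is a Prüfer $v$-multiplication domain or an almost Krull domain, then the Krull dimensions satisfy $\dim({\rm Int}(R))=\dim(R[X])$ (both sides may be infinite). Here, for a nonzero fractional ideal $I$ of $R$, put $I^{-1}=\{x\in K : xI\subseteq R\}$ and $I_v=(I^{-1})^{-1}$. The domain $R$ is a Prüfer $v$-multiplication domain (PVMD) if the ideals $I_v$, with $I$ a nonzero finitely generated fractional ideal, form a group under $(I_v,J_v)\mapsto (IJ)_v$; equivalently, for every such $I$ there is a nonzero finitely generated fractional ideal $J$ with $(IJ)_v=R$. A domain $A$ is a Krull domain if $A_p$ is a discrete valuation ring for every height-one prime $p$, $A=\bigcap_{{\rm ht}(p)=1}A_p$, and every nonzero element of $A$ lies in only finitely many height-one primes (so fields are Krull domains). The domain $R$ is almost Krull if $R_{\mathfrak m}$ is a Krull domain for every maximal ideal $\mathfrak m$ of $R$. -/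

import Mathlib

open scoped Polynomial nonZeroDivisors

/-- The ring `Int(R) = {f ∈ K[X] : f(R) ⊆ R}` of integer-valued polynomials over `R`,
where `K` is the quotient field of `R`. -/
noncomputable def IntegerValuedPolynomials (R K : Type*) [CommRing R] [Field K] [Algebra R K] :
    Subalgebra R K[X] where
  carrier := {f | ∀ r : R, f.eval (algebraMap R K r) ∈ (algebraMap R K).range}
  mul_mem' := by
    intro f g hf hg r
    rw [Polynomial.eval_mul]
    exact mul_mem (hf r) (hg r)
  add_mem' := by
    intro f g hf hg r
    rw [Polynomial.eval_add]
    exact add_mem (hf r) (hg r)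
  algebraMap_mem' := by
    intro a r
    rw [IsScalarTower.algebraMap_apply R K K[X], Polynomial.algebraMap_apply,
      Algebra.algebraMap_self_apply, Polynomial.eval_C]
    exact ⟨a, rfl⟩

/-- The divisorial closure `I_v = (R : (R : I))` of a fractional ideal `I` of a domain `R`
with quotient field `K`. In Mathlib `I⁻¹ = (R : I)` for `I ≠ 0`, and `0⁻¹ = 0`. -/
noncomputable def vClosure {R K : Type*} [CommRing R] [IsDomain R] [Field K] [Algebra R K]
    [IsFractionRing R K] (I : FractionalIdeal R⁰ K) : FractionalIdeal R⁰ K :=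
  (I⁻¹)⁻¹

/-- A Prüfer `v`-multiplication domain: the `v`-ideals of finite type `I_v`
(`I` a nonzero finitely generated fractional ideal) form a group under the `v`-multiplication
`(I_v, J_v) ↦ (I_v J_v)_v = (I J)_v`, whose identity is `R`. As this multiplication is always
commutative and associative with identity `R`, the condition is the existence of inverses. -/
def IsPVMD (R K : Type*) [CommRing R] [IsDomain R] [Field K] [Algebra R K]
    [IsFractionRing R K] : Prop :=
  ∀ I : FractionalIdeal R⁰ K, I ≠ 0 → (I : Submodule R K).FG →
    ∃ J : FractionalIdeal R⁰ K, J ≠ 0 ∧ (J : Submodule R K).FG ∧ vClosure (I * J) = 1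

/-- A Krull domain: the localizations at the height-one primes are discrete valuation rings,
their intersection (inside the quotient field) is the ring, and every nonzero element of the
ring lies in only finitely many height-one primes. Fields are Krull domains. -/
structure IsKrullDomain (A : Type*) [CommRing A] [IsDomain A] : Prop where
  isDiscreteValuationRing : ∀ (p : Ideal A) [p.IsPrime], p.height = 1 →
    IsDiscreteValuationRing (Localization.AtPrime p)
  iInf_localization_eq_bot : (⨅ p : {p : PrimeSpectrum A // p.asIdeal.height = 1},
    Localization.subalgebra.ofField (FractionRing A) p.1.asIdeal.primeCompl
      p.1.asIdeal.primeCompl_le_nonZeroDivisors) = ⊥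
  finite_character : ∀ a : A, a ≠ 0 →
    {p : PrimeSpectrum A | p.asIdeal.height = 1 ∧ a ∈ p.asIdeal}.Finite

/-- An almost Krull domain: the localization at every maximal ideal is a Krull domain. -/
def IsAlmostKrullDomain (R : Type*) [CommRing R] [IsDomain R] : Prop :=
  ∀ (m : Ideal R) [m.IsMaximal], IsKrullDomain (Localization.AtPrime m)

/-! At each maximal ideal `m`, either `R_m` is a valuation ring or `Int(R) ⊆ R_m[X]`. A chain of
primes of `R[X]` or `Int(R)` is examined at a maximal ideal containing the contraction of its top
prime. If `Int(R) ⊆ R_m[X]`, the two rings agree after inverting `R \ m`, so the chain transfers to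
the other ring. If `R_m` is a valuation ring, transcendence degree one bounds the length by `dim R +
1` (`LTSeries.length_le_ringKrullDim_add_one`), and both dimensions are at least `dim R + 1`.

The dichotomy rests on Lagrange interpolation: a nonmaximal prime `p` has infinite residue ring,
hence `Int(R) ⊆ R_p[X]`. A Krull domain `R_m` whose maximal ideal does not have height one is an
intersection of such `R_p`. For a PVMD, either some finitely generated `J ⊆ m` has `J⁻¹ = R`, and
then coefficients lying in `R_p` for all primes `p < m` lie in `R_m`; or there is no such `J`, and
`v`-invertibility makes `R_m` a valuation ring. -/

/-! ### Divisibility and content up to factors outside a prime. -/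

/-- A prime ideal `m` of `R` such that, of any two elements of `R`, one divides the other up to
a factor outside `m`. For a domain this says that `R` localized at `m` is a valuation ring. -/
def Ideal.IsLocallyValuative {R : Type*} [CommRing R] (m : Ideal R) : Prop :=
  ∀ a b : R, ∃ s ∉ m, a ∣ s * b ∨ b ∣ s * a

namespace Ideal.IsLocallyValuative

variable {R : Type*} [CommRing R] {m : Ideal R}

theorem exists_dvd_mul (hm : m.IsLocallyValuative) [m.IsPrime] (T : Finset R)
    (hT : T.Nonempty) : ∃ d ∈ T, ∃ s ∉ m, ∀ a ∈ T, d ∣ s * a := by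
  classical
  induction hT using Finset.Nonempty.cons_induction with
  | singleton a => exact ⟨a, by simp, 1, m.one_notMem, by simp⟩
  | cons a T _ _ ih =>
    obtain ⟨d, hd, s, hs, h⟩ := ih
    obtain ⟨t, ht, hdt | hat⟩ := hm d a
    · refine ⟨d, by simp [hd], s * t, fun h ↦ ((‹m.IsPrime›.mem_or_mem h).elim hs ht), ?_⟩
      intro b hb
      rcases Finset.mem_cons.1 hb with rfl | hb
      · rw [mul_assoc]; exact hdt.mul_left s
      · rw [mul_right_comm]; exact (h b hb).mul_right t
    · refine ⟨a, by simp, s * t, fun h ↦ ((‹m.IsPrime›.mem_or_mem h).elim hs ht), ?_⟩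
      intro b hb
      rcases Finset.mem_cons.1 hb with rfl | hb
      · exact dvd_mul_left _ _
      · rw [mul_right_comm, mul_comm]
        obtain ⟨c, hc⟩ := h b hb
        rw [hc, ← mul_assoc]
        exact hat.mul_right c

/-- Up to a factor outside `m`, a nonzero bivariate polynomial is the product of its content and
of a polynomial with a coefficient outside `m`. -/
theorem exists_primitive [IsDomain R] (hm : m.IsLocallyValuative) [m.IsPrime] {F : R[X][X]}
    (hF : F ≠ 0) : ∃ (d s : R) (F' : R[X][X]), d ≠ 0 ∧ s ∉ m ∧
      (∃ j k, (F'.coeff j).coeff k ∉ m) ∧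
      Polynomial.C (Polynomial.C s) * F = Polynomial.C (Polynomial.C d) * F' := by
  classical
  obtain ⟨j, hj⟩ := Polynomial.support_nonempty.2 hF
  obtain ⟨k, hk⟩ := Polynomial.support_nonempty.2 (Polynomial.mem_support_iff.1 hj)
  let T : Finset R := F.support.biUnion fun j ↦ (F.coeff j).support.image (F.coeff j).coeff
  have hT {a : R} : a ∈ T ↔ a ≠ 0 ∧ ∃ j k, (F.coeff j).coeff k = a := by
    simp only [T, Finset.mem_biUnion, Polynomial.mem_support_iff, Finset.mem_image]
    constructor
    · rintro ⟨j, _, k, hk, rfl⟩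
      exact ⟨hk, j, k, rfl⟩
    · rintro ⟨h, j, k, rfl⟩
      exact ⟨j, fun h' ↦ h (by simp [h']), k, h, rfl⟩
  obtain ⟨d, hd, s, hs, h⟩ := hm.exists_dvd_mul T
    ⟨_, hT.2 ⟨Polynomial.mem_support_iff.1 hk, j, k, rfl⟩⟩
  have hdvd : Polynomial.C (Polynomial.C d) ∣ Polynomial.C (Polynomial.C s) * F := by
    refine (Polynomial.C_dvd_iff_dvd_coeff _ _).2 fun j ↦
      (Polynomial.C_dvd_iff_dvd_coeff _ _).2 fun k ↦ ?_
    rw [Polynomial.coeff_C_mul, Polynomial.coeff_C_mul]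
    by_cases h0 : (F.coeff j).coeff k = 0
    · simp [h0]
    · exact h _ (hT.2 ⟨h0, j, k, rfl⟩)
  obtain ⟨F', hF'⟩ := hdvd
  obtain ⟨hd0, j, k, hjk⟩ := hT.1 hd
  refine ⟨d, s, F', hd0, hs, ⟨j, k, ?_⟩, hF'⟩
  have := congrArg (fun G ↦ (G.coeff j).coeff k) hF'
  simp only [Polynomial.coeff_C_mul, hjk] at this
  rw [mul_comm] at this
  rwa [← mul_left_cancel₀ hd0 this]

end Ideal.IsLocallyValuative

/-! ### Chains of primes in extensions of transcendence degree at most one. -/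

section PrimeChains

variable {R B : Type*} [CommRing R] [CommRing B] [Algebra R B]

/-- Let `P ≤ P'` be ideals, `P` prime, and `x ∈ P'` outside `P`. If `G(x) ∈ P` and `G` has a
coefficient outside `P`, then some coefficient of `G` outside `P` lies in `P'`. -/
theorem Polynomial.exists_coeff_mem_of_eval_mem {P P' : Ideal B} [P.IsPrime] (hPP' : P ≤ P')
    {x : B} (hx : x ∉ P) (hx' : x ∈ P') (G : B[X]) (hG : G.eval x ∈ P)
    (hGP : ∃ j, G.coeff j ∉ P) : ∃ j, G.coeff j ∉ P ∧ G.coeff j ∈ P' := by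
  induction hn : G.natDegree using Nat.strong_induction_on generalizing G with
  | _ n ih =>
  subst hn
  -- If the constant coefficient is in `P`, then so is `x * G.divX(x)`; as `x ∉ P`, the factor `x`
  -- cancels and the degree drops.
  by_cases h0 : G.coeff 0 ∈ P
  · obtain ⟨j, hj⟩ := hGP
    cases j with
    | zero => exact absurd h0 hj
    | succ j =>
      have hdeg : G.natDegree ≠ 0 := by
        intro h
        rw [Polynomial.coeff_eq_zero_of_natDegree_lt (by omega)] at hj
        exact hj P.zero_mem
      have hev : G.divX.eval x ∈ P := by
        rw [← G.divX_mul_X_add] at hG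
        simp only [Polynomial.eval_add, Polynomial.eval_mul, Polynomial.eval_X,
          Polynomial.eval_C] at hG
        exact (‹P.IsPrime›.mem_or_mem ((P.add_mem_iff_left h0).1 hG)).resolve_right hx
      obtain ⟨i, hi⟩ := ih _ (by rw [Polynomial.natDegree_divX_eq_natDegree_tsub_one]; omega)
        G.divX hev ⟨j, by rwa [Polynomial.coeff_divX]⟩ rfl
      exact ⟨i + 1, by rwa [Polynomial.coeff_divX] at hi⟩
  · refine ⟨0, h0, ?_⟩
    rw [← G.divX_mul_X_add] at hG
    simp only [Polynomial.eval_add, Polynomial.eval_mul, Polynomial.eval_X,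
      Polynomial.eval_C] at hG
    exact (P'.add_mem_iff_right (P'.mul_mem_left _ hx')).1 (hPP' hG)

/-- If the polynomial ring in two variables does not embed in `B`, then any two elements of `B`
satisfy a nontrivial polynomial relation over `R`. -/
theorem exists_bivariate_relation [IsDomain R]
    (h : ∀ f : R[X][X] →ₐ[R] B, ¬ Function.Injective f) (x y : B) :
    ∃ F : R[X][X], F ≠ 0 ∧ (F.map (Polynomial.aeval y : R[X] →ₐ[R] B).toRingHom).eval x = 0 := by
  let f : R[X][X] →ₐ[R] B :=
    { Polynomial.eval₂RingHom (Polynomial.aeval y : R[X] →ₐ[R] B).toRingHom x with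
      commutes' := fun r ↦ by
        simp [IsScalarTower.algebraMap_apply R R[X] R[X][X]] }
  have := h f
  rw [injective_iff_map_eq_zero] at this
  push Not at this
  obtain ⟨F, hF, hF0⟩ := this
  exact ⟨F, hF0, by rw [Polynomial.eval_map]; exact hF⟩

/-- The ring `B` is algebraic modulo the prime ideal `P`, by relations with a coefficient
outside `m`. -/
def AlgebraicModulo (m : Ideal R) (P : Ideal B) : Prop :=
  ∀ y : B, ∃ G : R[X], (∃ j, G.coeff j ∉ m) ∧ Polynomial.aeval y G ∈ P

theorem AlgebraicModulo.mono {m : Ideal R} {P P' : Ideal B} (h : AlgebraicModulo m P)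
    (hP : P ≤ P') : AlgebraicModulo m P' := fun y ↦
  let ⟨G, hG, hy⟩ := h y
  ⟨G, hG, hP hy⟩

/-- For `x ∈ P' \ P`, a relation for `x` modulo `P` has a coefficient in `P'` but not in `P`, and
this coefficient comes from `R`. -/
theorem AlgebraicModulo.comap_lt {m : Ideal R} {P P' : Ideal B} [P.IsPrime]
    (h : AlgebraicModulo m P) (hP : P < P') (hm : P.comap (algebraMap R B) ≤ m) :
    P.comap (algebraMap R B) < P'.comap (algebraMap R B) := by
  refine lt_of_le_not_ge (Ideal.comap_mono hP.le) fun hle ↦ ?_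
  obtain ⟨x, hx', hx⟩ := SetLike.exists_of_lt hP
  obtain ⟨G, ⟨j, hj⟩, hG⟩ := h x
  obtain ⟨i, hi, hi'⟩ := Polynomial.exists_coeff_mem_of_eval_mem hP.le hx hx'
    (G.map (algebraMap R B)) (by rwa [Polynomial.eval_map_algebraMap])
    ⟨j, fun h ↦ hj (hm (by rwa [Polynomial.coeff_map] at h))⟩
  rw [Polynomial.coeff_map] at hi hi'
  exact hi (hle hi')

/-- A step between primes with the same contraction uses up the one available transcendence degree:
a relation between `x ∈ P' \ P` and any `y` forces an algebraic relation for `y` modulo `P'`. -/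
theorem algebraicModulo_of_comap_le [IsDomain R] [IsDomain B] [FaithfulSMul R B]
    {m : Ideal R} [m.IsPrime] (hV : m.IsLocallyValuative)
    (hB : ∀ f : R[X][X] →ₐ[R] B, ¬ Function.Injective f)
    {P P' : Ideal B} [P.IsPrime] [P'.IsPrime] (hP : P < P')
    (hle : P'.comap (algebraMap R B) ≤ P.comap (algebraMap R B))
    (hm : P'.comap (algebraMap R B) ≤ m) : AlgebraicModulo m P' := by
  intro y
  obtain ⟨x, hx', hx⟩ := SetLike.exists_of_lt hP
  obtain ⟨F, hF0, hF⟩ := exists_bivariate_relation hB x y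
  obtain ⟨d, s, F', hd, -, ⟨j, k, hjk⟩, hsF⟩ := hV.exists_primitive hF0
  have hF' : (F'.map (Polynomial.aeval y : R[X] →ₐ[R] B).toRingHom).eval x = 0 := by
    have := congrArg (fun H ↦ (H.map (Polynomial.aeval y : R[X] →ₐ[R] B).toRingHom).eval x) hsF
    simp only [Polynomial.map_mul, Polynomial.eval_mul, hF, mul_zero, Polynomial.map_C,
      Polynomial.eval_C] at this
    refine (mul_eq_zero.1 this.symm).resolve_left ?_
    simpa using hd
  by_cases hall : ∀ i, Polynomial.aeval y (F'.coeff i) ∈ P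
  · exact ⟨F'.coeff j, ⟨k, hjk⟩, hP.le (hall j)⟩
  push Not at hall
  obtain ⟨i, hi⟩ := hall
  obtain ⟨i, hi, hi'⟩ := Polynomial.exists_coeff_mem_of_eval_mem hP.le hx hx' _
    (hF' ▸ P.zero_mem) ⟨i, by rw [Polynomial.coeff_map]; exact hi⟩
  rw [Polynomial.coeff_map] at hi hi'
  change Polynomial.aeval y _ ∉ P at hi
  change Polynomial.aeval y _ ∈ P' at hi'
  set G := F'.coeff i
  have hG0 : G ≠ 0 := fun h ↦ hi (by simp [h])
  -- `G(y) ∈ P'`, but all coefficients of `G` may lie in `m`. Its content `e` is split off, viewing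
  -- `G` as a constant bivariate polynomial; `e ∈ P'` would give `e ∈ P` and hence `G(y) ∈ P`.
  obtain ⟨e, t, H, he, ht, ⟨a, b, hab⟩, hH⟩ := hV.exists_primitive (Polynomial.C_ne_zero.2 hG0)
  have hHa (a) := congrArg (fun H ↦ H.coeff a) hH
  simp only [Polynomial.coeff_C_mul] at hHa
  have ha0 : a = 0 := by
    by_contra ha
    have := hHa a
    rw [Polynomial.coeff_C_of_ne_zero ha, mul_zero, eq_comm, mul_eq_zero] at this
    rw [this.resolve_left (by simpa using he)] at hab
    simp at hab
  subst ha0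
  have hH0 := hHa 0
  rw [Polynomial.coeff_C_zero] at hH0
  have hev := congrArg (Polynomial.aeval y) hH0
  simp only [map_mul, Polynomial.aeval_C] at hev
  refine ⟨H.coeff 0, ⟨b, hab⟩, ?_⟩
  have hmem : algebraMap R B e * Polynomial.aeval y (H.coeff 0) ∈ P' :=
    hev ▸ P'.mul_mem_left _ hi'
  refine (‹P'.IsPrime›.mem_or_mem hmem).resolve_left fun heP ↦ ?_
  have htP : algebraMap R B t * Polynomial.aeval y G ∈ P :=
    hev ▸ P.mul_mem_right _ (hle heP : algebraMap R B e ∈ P)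
  exact ht (hm (hP.le ((‹P.IsPrime›.mem_or_mem htP).resolve_right hi)))

/-- Let `R ⊆ B` be domains such that `B` has transcendence degree at most one over `R`. If `R` is
a valuation domain locally at `m`, then every chain of primes of `B` lying over primes contained
in `m` has length at most `dim R + 1`. -/
theorem LTSeries.length_le_ringKrullDim_add_one [IsDomain R] [IsDomain B] [FaithfulSMul R B]
    {m : Ideal R} [m.IsPrime] (hV : m.IsLocallyValuative)
    (hB : ∀ f : R[X][X] →ₐ[R] B, ¬ Function.Injective f) (c : LTSeries (PrimeSpectrum B))
    (hc : c.last.asIdeal.comap (algebraMap R B) ≤ m) :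
    (c.length : WithBot ℕ∞) ≤ ringKrullDim R + 1 := by
  let q (i : Fin (c.length + 1)) : PrimeSpectrum R := (c i).comap (algebraMap R B)
  have hqm (i) : (q i).asIdeal ≤ m :=
    (Ideal.comap_mono (c.monotone (Fin.le_last i) : c i ≤ c (Fin.last _))).trans hc
  -- The contraction can fail to grow at most once: from then on `AlgebraicModulo` holds and every
  -- later step is strict in `R`.
  have key (i : ℕ) (hi : i < c.length + 1) : (i : ℕ∞) ≤ Order.height (q ⟨i, hi⟩) ∨
      AlgebraicModulo m (c ⟨i, hi⟩).asIdeal ∧ (i : ℕ∞) ≤ Order.height (q ⟨i, hi⟩) + 1 := by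
    induction i with
    | zero => simp
    | succ i ih =>
      have hi' : i < c.length + 1 := by omega
      have hlt : (c ⟨i, hi'⟩).asIdeal < (c ⟨i + 1, hi⟩).asIdeal :=
        c.strictMono (by simp)
      have hle : q ⟨i, hi'⟩ ≤ q ⟨i + 1, hi⟩ := Ideal.comap_mono hlt.le
      have hht (h : q ⟨i, hi'⟩ < q ⟨i + 1, hi⟩) :
          Order.height (q ⟨i, hi'⟩) + 1 ≤ Order.height (q ⟨i + 1, hi⟩) :=
        Order.height_add_one_le h
      push_cast
      rcases ih hi' with h | ⟨ha, h⟩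
      · by_cases hq : q ⟨i, hi'⟩ < q ⟨i + 1, hi⟩
        · exact .inl ((add_le_add_left h 1).trans (hht hq))
        · refine .inr ⟨algebraicModulo_of_comap_le hV hB hlt ?_ (hqm _),
            add_le_add_left (h.trans (Order.height_mono hle)) 1⟩
          exact not_not.1 fun h ↦ hq (lt_of_le_not_ge hle h)
      · exact .inr ⟨ha.mono hlt.le,
          (add_le_add_left h 1).trans (add_le_add_left (hht (ha.comap_lt hlt (hqm _))) 1)⟩
  have hn : (c.length : ℕ∞) ≤ Order.height (q (Fin.last _)) + 1 := by
    rcases key c.length (by omega) with h | ⟨-, h⟩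
    · exact h.trans le_self_add
    · exact h
  calc (c.length : WithBot ℕ∞) ≤ ((Order.height (q (Fin.last _)) + 1 : ℕ∞) : WithBot ℕ∞) := by
        exact_mod_cast hn
    _ ≤ ringKrullDim R + 1 := by
        push_cast
        gcongr
        exact Order.height_le_krullDim _

end PrimeChains

/-! ### Comparison of transcendence degrees. -/

section Transcendence

theorem Polynomial.not_injective_algHom_of_field {R K : Type*} [CommRing R] [IsDomain R] [Field K]
    [Algebra R K] [IsFractionRing R K] (f : R[X][X] →ₐ[R] K[X]) : ¬ Function.Injective f := by
  intro hf
  have h := lift_trdeg_le_of_injective f hf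
  have h2 : Algebra.trdeg R R[X][X] = 2 := by
    rw [← trdeg_add_eq R R[X] (A := R[X][X]), Polynomial.trdeg_of_isDomain,
      Polynomial.trdeg_of_isDomain, one_add_one_eq_two]
  have h0 : Algebra.IsAlgebraic R K := IsFractionRing.comap_isAlgebraic_iff.2
    (inferInstance : Algebra.IsAlgebraic K K)
  have h1 := lift_trdeg_add_eq R K K[X]
  rw [trdeg_eq_zero, Polynomial.trdeg_of_isDomain] at h1
  rw [Cardinal.lift_zero, zero_add, Cardinal.lift_inj] at h1
  rw [h2, ← h1, Cardinal.lift_one, Cardinal.lift_ofNat] at h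
  exact absurd h (by norm_num)

end Transcendence

/-! ### Transfer of chains between rings with the same fractions over `S`. -/

section BirationalChains

variable {A B : Type*} [CommRing A] [CommRing B] [Algebra A B]
  {S : Submonoid A}

/-- The extension to `B` of a prime ideal of `A` disjoint from `S`, when `B` lies between `A` and
its localization at `S`. -/
def PrimeSpectrum.extendOfFractions [FaithfulSMul A B]
    (hS : ∀ b : B, ∃ s ∈ S, ∃ a, algebraMap A B s * b = algebraMap A B a)
    (Q : PrimeSpectrum A) (hQ : Disjoint (Q.asIdeal : Set A) S) : PrimeSpectrum B where
  asIdeal :=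
    { carrier := {b | ∃ s ∈ S, ∃ a ∈ Q.asIdeal, algebraMap A B s * b = algebraMap A B a}
      zero_mem' := ⟨1, S.one_mem, 0, Q.asIdeal.zero_mem, by simp⟩
      add_mem' := by
        rintro b c ⟨s, hs, a, ha, h⟩ ⟨t, ht, a', ha', h'⟩
        refine ⟨s * t, S.mul_mem hs ht, t * a + s * a',
          add_mem (Ideal.mul_mem_left _ _ ha) (Ideal.mul_mem_left _ _ ha'), ?_⟩
        rw [map_add, map_mul, map_mul, map_mul, ← h, ← h']
        ring
      smul_mem' := by
        rintro c b ⟨s, hs, a, ha, h⟩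
        obtain ⟨t, ht, a', h'⟩ := hS c
        refine ⟨s * t, S.mul_mem hs ht, a' * a, Ideal.mul_mem_left _ _ ha, ?_⟩
        rw [map_mul, map_mul, ← h, ← h', smul_eq_mul]
        ring }
  isPrime := by
    refine ⟨?_, ?_⟩
    · rw [Ideal.ne_top_iff_one]
      rintro ⟨s, hs, a, ha, h⟩
      rw [mul_one] at h
      rw [FaithfulSMul.algebraMap_injective A B h] at hs
      exact hQ.le_bot ⟨ha, hs⟩
    · rintro b c ⟨s, hs, a, ha, h⟩
      obtain ⟨t, ht, b', hb⟩ := hS b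
      obtain ⟨u, hu, c', hc⟩ := hS c
      have : s * (b' * c') = t * u * a := by
        apply FaithfulSMul.algebraMap_injective A B
        simp only [map_mul, ← h, ← hb, ← hc]
        ring
      have hmem : s * (b' * c') ∈ Q.asIdeal := this ▸ Ideal.mul_mem_left _ _ ha
      have hs' : s ∉ Q.asIdeal := fun h ↦ hQ.le_bot ⟨h, hs⟩
      rcases Q.isPrime.mem_or_mem ((Q.isPrime.mem_or_mem hmem).resolve_left hs') with h | h
      · exact .inl ⟨t, ht, b', h, hb⟩
      · exact .inr ⟨u, hu, c', h, hc⟩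

theorem LTSeries.length_le_of_fractions [FaithfulSMul A B]
    (hS : ∀ b : B, ∃ s ∈ S, ∃ a, algebraMap A B s * b = algebraMap A B a)
    (c : LTSeries (PrimeSpectrum A)) (hc : Disjoint (c.last.asIdeal : Set A) S) :
    (c.length : WithBot ℕ∞) ≤ ringKrullDim B := by
  have hd (i) : Disjoint ((c i).asIdeal : Set A) S :=
    hc.mono_left (c.monotone (Fin.le_last i) : c i ≤ c (Fin.last _))
  let c' : LTSeries (PrimeSpectrum B) :=
    { length := c.length
      toFun := fun i ↦ (c i).extendOfFractions hS (hd i)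
      step := fun i ↦ by
        have hlt : (c i.castSucc).asIdeal < (c i.succ).asIdeal := c.step i
        obtain ⟨a, ha', ha⟩ := SetLike.exists_of_lt hlt
        refine lt_of_le_not_ge (α := PrimeSpectrum B) ?_ fun hle ↦ ?_
        · rintro b ⟨s, hs, a, ha, h⟩
          exact ⟨s, hs, a, hlt.le ha, h⟩
        · obtain ⟨s, hs, b, hb, h⟩ := hle (⟨1, S.one_mem, a, ha', by simp⟩ :
            algebraMap A B a ∈ ((c i.succ).extendOfFractions hS (hd i.succ)).asIdeal)
          rw [← map_mul] at h
          have hmem : s * a ∈ (c i.castSucc).asIdeal :=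
            FaithfulSMul.algebraMap_injective A B h ▸ hb
          exact ((c i.castSucc).isPrime.mem_or_mem hmem).elim
            (fun h ↦ (hd _).le_bot ⟨h, hs⟩) ha }
  exact Order.LTSeries.length_le_krullDim c'

theorem LTSeries.length_le_of_comap_disjoint
    (hS : ∀ b : B, ∃ s ∈ S, ∃ a, algebraMap A B s * b = algebraMap A B a)
    (c : LTSeries (PrimeSpectrum B))
    (hc : Disjoint (c.last.asIdeal.comap (algebraMap A B) : Set A) S) :
    (c.length : WithBot ℕ∞) ≤ ringKrullDim A := by
  have hd (i) : Disjoint ((c i).asIdeal.comap (algebraMap A B) : Set A) S :=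
    hc.mono_left (Ideal.comap_mono (c.monotone (Fin.le_last i) : c i ≤ c (Fin.last _)))
  let c' : LTSeries (PrimeSpectrum A) :=
    { length := c.length
      toFun := fun i ↦ (c i).comap (algebraMap A B)
      step := fun i ↦ by
        have hlt : (c i.castSucc).asIdeal < (c i.succ).asIdeal := c.step i
        refine lt_of_le_not_ge (Ideal.comap_mono hlt.le) fun hle ↦ hlt.not_ge fun b hb ↦ ?_
        obtain ⟨s, hs, a, h⟩ := hS b
        have ha : a ∈ (c i.succ).asIdeal.comap (algebraMap A B) :=
          Ideal.mem_comap.2 (h ▸ Ideal.mul_mem_left _ _ hb)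
        have ha' : algebraMap A B s * b ∈ (c i.castSucc).asIdeal := h ▸ hle ha
        exact ((c i.castSucc).isPrime.mem_or_mem ha').resolve_left
          fun h ↦ (hd _).le_bot ⟨h, hs⟩ }
  exact Order.LTSeries.length_le_krullDim c'

end BirationalChains

/-! ### Coefficients of integer-valued polynomials; the PVMD case. -/

section IntegerValued

theorem Ideal.infinite_quotient_of_not_isMaximal {R : Type*} [CommRing R] {p : Ideal R}
    [p.IsPrime] (hp : ¬ p.IsMaximal) : Infinite (R ⧸ p) := by
  by_contra h
  rw [not_infinite_iff_finite] at h
  exact hp (Ideal.Quotient.maximal_of_isField p (Finite.isField_of_domain (R ⧸ p)))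

theorem Ideal.not_isMaximal_of_lt {R : Type*} [CommRing R] {p m : Ideal R} (h : p < m)
    (hm : m ≠ ⊤) : ¬ p.IsMaximal := fun hp ↦ h.ne (hp.eq_of_le hm h.le)

variable {R K : Type*} [CommRing R] [IsDomain R] [Field K] [Algebra R K] [IsFractionRing R K]

/-- The localization of the domain `R` at the prime ideal `p`, inside the fraction field. -/
noncomputable abbrev Ideal.localizationIn (K : Type*) [Field K] [Algebra R K] [IsFractionRing R K]
    (p : Ideal R) [p.IsPrime] : Subalgebra R K :=
  Localization.subalgebra.ofField K p.primeCompl p.primeCompl_le_nonZeroDivisors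

theorem Ideal.mem_localizationIn {p : Ideal R} [p.IsPrime] {x : K} :
    x ∈ p.localizationIn K ↔ ∃ s ∉ p, ∃ r, algebraMap R K s * x = algebraMap R K r := by
  change (∃ (a s : R) (_ : s ∈ p.primeCompl), x = algebraMap R K a * (algebraMap R K s)⁻¹) ↔ _
  have h0 (s : R) (hs : s ∉ p) : algebraMap R K s ≠ 0 := fun h ↦
    hs (by rw [(FaithfulSMul.algebraMap_eq_zero_iff R K).1 h]; exact p.zero_mem)
  constructor
  · rintro ⟨a, s, hs, rfl⟩
    refine ⟨s, hs, a, ?_⟩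
    field_simp [h0 s hs]
  · rintro ⟨s, hs, r, h⟩
    refine ⟨r, s, hs, ?_⟩
    rw [← h]
    field_simp [h0 s hs]

theorem Ideal.mem_localizationIn_of_mul_mem {p : Ideal R} [p.IsPrime] {x : K} {s : R} (hs : s ∉ p)
    (h : x * algebraMap R K s ∈ p.localizationIn K) : x ∈ p.localizationIn K := by
  rw [Ideal.mem_localizationIn] at h ⊢
  obtain ⟨t, ht, r, h⟩ := h
  refine ⟨t * s, fun hts ↦ (‹p.IsPrime›.mem_or_mem hts).elim ht hs, r, ?_⟩
  rw [← h, map_mul]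
  ring

/-- For a finitely generated ideal with trivial inverse, the inverse remains trivial after
localization. -/
theorem Ideal.mem_localizationIn_of_forall_mul_mem {m : Ideal R} [m.IsPrime] {J : Ideal R}
    (hJ : J.FG)
    (hinv : ∀ x : K, (∀ j ∈ J, x * algebraMap R K j ∈ (algebraMap R K).range) →
      x ∈ (algebraMap R K).range) {x : K}
    (hx : ∀ j ∈ J, x * algebraMap R K j ∈ m.localizationIn K) : x ∈ m.localizationIn K := by
  -- Finite generation gives a common denominator `s`, so that `s * x` lies in the inverse of `J`,
  -- which is `R`.
  have key : ∃ s ∉ m, ∀ j ∈ J, algebraMap R K s * x * algebraMap R K j ∈ (algebraMap R K).range := by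
    clear hinv
    induction J, hJ using Submodule.fg_induction with
    | singleton a =>
      obtain ⟨s, hs, r, h⟩ := Ideal.mem_localizationIn.1 (hx a (Ideal.mem_span_singleton_self a))
      refine ⟨s, hs, fun j hj ↦ ?_⟩
      obtain ⟨b, rfl⟩ := Ideal.mem_span_singleton.1 hj
      exact ⟨r * b, by rw [map_mul, ← h, map_mul]; ring⟩
    | sup I J _ _ hI hJ =>
      obtain ⟨s, hs, h⟩ := hI fun j hj ↦ hx j (Submodule.mem_sup_left hj)
      obtain ⟨t, ht, h'⟩ := hJ fun j hj ↦ hx j (Submodule.mem_sup_right hj)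
      refine ⟨s * t, fun hst ↦ (‹m.IsPrime›.mem_or_mem hst).elim hs ht, fun j hj ↦ ?_⟩
      obtain ⟨y, hy, z, hz, rfl⟩ := Submodule.mem_sup.1 hj
      obtain ⟨a, ha⟩ := h y hy
      obtain ⟨b, hb⟩ := h' z hz
      refine ⟨t * a + s * b, ?_⟩
      simp only [map_add, map_mul, ha, hb]
      ring
  obtain ⟨s, hs, h⟩ := key
  obtain ⟨r, hr⟩ := hinv _ h
  exact Ideal.mem_localizationIn.2 ⟨s, hs, r, hr.symm⟩

open Polynomial in
/-- At a prime with infinite residue ring, integer-valued polynomials have coefficients in the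
localization. -/
theorem IntegerValuedPolynomials.coeff_mem_localizationIn {p : Ideal R} [p.IsPrime]
    [Infinite (R ⧸ p)] {f : K[X]} (hf : f ∈ IntegerValuedPolynomials R K) (n : ℕ) :
    f.coeff n ∈ p.localizationIn K := by
  classical
  let W := p.localizationIn K
  -- Nodes in distinct classes modulo `p`: their differences are units of `R_p`, so the Lagrange
  -- interpolation formula has coefficients in `R_p`.
  let u (i : ℕ) : R := Quotient.out (Infinite.natEmbedding (R ⧸ p) i)
  have hu {i j : ℕ} (hij : i ≠ j) : u i - u j ∉ p := by
    rw [← Ideal.Quotient.eq, Ideal.Quotient.mk_out, Ideal.Quotient.mk_out]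
    exact fun h ↦ hij ((Infinite.natEmbedding (R ⧸ p)).injective h)
  let v (i : ℕ) : K := algebraMap R K (u i)
  have hinj : Set.InjOn v (Finset.range (f.natDegree + 1) : Set ℕ) := by
    intro i _ j _ hij
    by_contra h
    refine hu h ?_
    rw [FaithfulSMul.algebraMap_injective R K hij, sub_self]
    exact p.zero_mem
  have hdeg : f.degree < (Finset.range (f.natDegree + 1)).card := by
    rw [Finset.card_range]
    exact degree_le_natDegree.trans_lt (by exact_mod_cast Nat.lt_succ_self _)
  have hC {x : K} (hx : x ∈ W) : C x ∈ (mapRingHom (algebraMap W K)).range := ⟨C ⟨x, hx⟩, by simp⟩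
  have hlift : f ∈ (mapRingHom (algebraMap W K)).range := by
    rw [Lagrange.eq_interpolate hinj hdeg, Lagrange.interpolate_apply]
    refine sum_mem fun i _ ↦ mul_mem (hC ?_) (prod_mem fun j hj ↦ mul_mem (hC ?_) (sub_mem ?_ ?_))
    · obtain ⟨r, hr⟩ := hf (u i)
      rw [← hr]
      exact W.algebraMap_mem r
    · rw [Ideal.mem_localizationIn]
      refine ⟨u i - u j, hu (Finset.ne_of_mem_erase hj).symm, 1, ?_⟩
      rw [map_sub, map_one, mul_inv_cancel₀]
      intro h
      rw [← map_sub, FaithfulSMul.algebraMap_eq_zero_iff] at h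
      exact hu (Finset.ne_of_mem_erase hj).symm (h ▸ p.zero_mem)
    · exact ⟨X, by simp⟩
    · exact hC (W.algebraMap_mem _)
  obtain ⟨w, rfl⟩ := hlift
  rw [coe_mapRingHom, coeff_map]
  exact (w.coeff n).2

open Polynomial in
theorem Polynomial.exists_smul_eq_map {p : Ideal R} [p.IsPrime] {f : K[X]}
    (hf : ∀ n, f.coeff n ∈ p.localizationIn K) :
    ∃ s ∉ p, ∃ g : R[X], C (algebraMap R K s) * f = g.map (algebraMap R K) := by
  simp only [Ideal.mem_localizationIn] at hf
  choose s hs r hr using hf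
  refine ⟨∏ n ∈ f.support, s n, fun h ↦ ?_, ?_⟩
  · obtain ⟨i, _, hi⟩ := (Ideal.IsPrime.prod_mem_iff (hp := ‹p.IsPrime›)).1 h
    exact hs i hi
  · have : C (algebraMap R K (∏ n ∈ f.support, s n)) * f ∈ lifts (algebraMap R K) := by
      rw [lifts_iff_coeff_lifts]
      intro n
      by_cases hn : n ∈ f.support
      · rw [coeff_C_mul, ← Finset.prod_erase_mul _ _ hn, map_mul, mul_assoc, hr, ← map_mul]
        exact ⟨_, rfl⟩
      · rw [coeff_C_mul, notMem_support_iff.1 hn, mul_zero]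
        exact ⟨0, map_zero _⟩
    obtain ⟨g, hg⟩ := this
    exact ⟨g, hg.symm⟩

/-- If some finitely generated ideal `J ⊆ m` has trivial inverse, then integer-valued polynomials
have coefficients in the localization at `m`. -/
theorem IntegerValuedPolynomials.coeff_mem_localizationIn_of_inverse_trivial {m : Ideal R}
    [m.IsPrime] {J : Ideal R} (hJ : J.FG) (hJm : J ≤ m)
    (hinv : ∀ x : K, (∀ j ∈ J, x * algebraMap R K j ∈ (algebraMap R K).range) →
      x ∈ (algebraMap R K).range)
    {f : K[X]} (hf : f ∈ IntegerValuedPolynomials R K) (n : ℕ) :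
    f.coeff n ∈ m.localizationIn K := by
  set c := f.coeff n with hc
  -- The ideal of denominators of `c` relative to `R_m`; the aim is `J ^ k ≤ 𝔟` for some `k`.
  let 𝔟 : Ideal R :=
    { carrier := {r | c * algebraMap R K r ∈ m.localizationIn K}
      zero_mem' := by simp
      add_mem' := fun {a b} ha hb ↦ by
        rw [Set.mem_ofPred_eq, map_add, mul_add]
        exact add_mem ha hb
      smul_mem' := fun a b hb ↦ by
        rw [Set.mem_ofPred_eq, smul_eq_mul, map_mul, mul_left_comm]
        exact mul_mem ((m.localizationIn K).algebraMap_mem a) hb }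
  have hrad : J ≤ 𝔟.radical := by
    intro j hj
    by_contra hjr
    -- If no power of `j` is in `𝔟`, some prime `p ⊇ 𝔟` lies in `m` and omits `j`, so `p < m`. Then
    -- `c ∈ R_p` supplies an element of `𝔟` outside `p`, a contradiction.
    have hdisj : Disjoint (𝔟 : Set R) (m.primeCompl ⊔ Submonoid.powers j : Submonoid R) := by
      rw [Set.disjoint_left]
      intro r hr hr'
      obtain ⟨s, hs, _, ⟨k, rfl⟩, rfl⟩ := Submonoid.mem_sup.1 hr'
      refine hjr ⟨k, Ideal.mem_localizationIn_of_mul_mem hs ?_⟩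
      rw [mul_assoc, ← map_mul, mul_comm (j ^ k)]
      exact hr
    obtain ⟨p, hp, hbp, hpS⟩ := Ideal.exists_le_prime_disjoint 𝔟 _ hdisj
    rw [Set.disjoint_left] at hpS
    have hpm : p < m := by
      refine lt_of_le_of_ne (fun a ha ↦ ?_) fun h ↦ ?_
      · by_contra ham
        exact hpS ha (Submonoid.mem_sup_left (S := m.primeCompl) ham)
      · exact hpS (h ▸ hJm hj) (Submonoid.mem_sup_right (Submonoid.mem_powers j))
    have := Ideal.infinite_quotient_of_not_isMaximal
      (Ideal.not_isMaximal_of_lt hpm ‹m.IsPrime›.ne_top)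
    obtain ⟨s, hs, r, h⟩ := Ideal.mem_localizationIn.1 (coeff_mem_localizationIn (p := p) hf n)
    refine hs (hbp ?_)
    change c * algebraMap R K s ∈ m.localizationIn K
    rw [mul_comm, h]
    exact (m.localizationIn K).algebraMap_mem r
  obtain ⟨k, hk⟩ := Ideal.exists_pow_le_of_le_radical_of_fg hrad hJ
  have key (k : ℕ) : ∀ x : K, (∀ j ∈ J ^ k, x * algebraMap R K j ∈ m.localizationIn K) →
      x ∈ m.localizationIn K := by
    induction k with
    | zero => exact fun x hx ↦ by simpa using hx 1 (by simp)
    | succ k ih =>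
      refine fun x hx ↦ ih x fun i hi ↦
        Ideal.mem_localizationIn_of_forall_mul_mem hJ hinv fun j hj ↦ ?_
      rw [mul_assoc, ← map_mul]
      exact hx _ (pow_succ J k ▸ Ideal.mul_mem_mul hi hj)
  exact key k c fun j hj ↦ hk hj

/-- With `I = (a, b)` and `(IJ)_v = R`, the product `IJ` is a finitely generated ideal with trivial
inverse, so by `hm` it is not inside `m`. Hence `a * j` or `b * j` lies outside `m` for some `j ∈
J`. If `u = a * j`, then `u * b = a * (b * j)` with `b * j ∈ R`; the other case is symmetric. -/
theorem IsPVMD.isLocallyValuative (hR : IsPVMD R K) {m : Ideal R} [m.IsPrime]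
    (hm : ∀ J : Ideal R, J.FG → J ≤ m → ∃ x : K,
      (∀ j ∈ J, x * algebraMap R K j ∈ (algebraMap R K).range) ∧ x ∉ (algebraMap R K).range) :
    m.IsLocallyValuative := by
  intro a b
  by_cases ha : a = 0
  · exact ⟨1, m.one_notMem, .inr (by simp [ha])⟩
  let I : FractionalIdeal R⁰ K := (Ideal.span {a, b} : Ideal R)
  have haI : algebraMap R K a ∈ I := by
    rw [FractionalIdeal.mem_coeIdeal]; exact ⟨a, Ideal.subset_span (by simp), rfl⟩
  have hbI : algebraMap R K b ∈ I := by
    rw [FractionalIdeal.mem_coeIdeal]; exact ⟨b, Ideal.subset_span (by simp), rfl⟩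
  have hI0 : I ≠ 0 := by
    rw [FractionalIdeal.coeIdeal_ne_zero]
    exact fun h ↦ ha (by simpa using (h ▸ Ideal.subset_span (by simp) : a ∈ (⊥ : Ideal R)))
  have hIfg : (I : Submodule R K).FG := by
    rw [FractionalIdeal.coe_coeIdeal, IsLocalization.coeSubmodule_fg _
      (FaithfulSMul.algebraMap_injective R K)]
    exact Submodule.fg_span (Set.toFinite _)
  obtain ⟨J, hJ0, hJfg, hIJ⟩ := hR I hI0 hIfg
  have hIJ0 : I * J ≠ 0 := by
    rw [Ne, FractionalIdeal.eq_zero_iff] at hJ0 ⊢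
    intro h
    refine hJ0 fun j hj ↦ ?_
    exact (mul_eq_zero.1 (h _ (FractionalIdeal.mul_mem_mul haI hj))).resolve_left (by simpa using ha)
  have hinv0 : (I * J)⁻¹ ≠ 0 := fun h ↦ by
    rw [vClosure, h, FractionalIdeal.inv_zero'] at hIJ
    exact zero_ne_one hIJ
  have hle : I * J ≤ 1 := by
    rw [← hIJ, vClosure]
    intro x hx
    rw [FractionalIdeal.mem_inv_iff hinv0]
    intro y hy
    rw [mul_comm]
    exact (FractionalIdeal.mem_inv_iff hIJ0).1 hy x hx
  have hone : (I * J)⁻¹ ≤ 1 := by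
    intro x hx
    have h1 : (1 : K) ∈ vClosure (I * J) := hIJ ▸ FractionalIdeal.one_mem_one R⁰
    simpa using (FractionalIdeal.mem_inv_iff hinv0).1 h1 x hx
  by_cases hex : ∃ j ∈ J, ∃ u ∉ m, algebraMap R K u = algebraMap R K a * j ∨
      algebraMap R K u = algebraMap R K b * j
  · obtain ⟨j, hj, u, hu, h | h⟩ := hex
    · obtain ⟨w, hw⟩ := (FractionalIdeal.mem_one_iff _).1 (hle (FractionalIdeal.mul_mem_mul hbI hj))
      refine ⟨u, hu, .inl ⟨w, FaithfulSMul.algebraMap_injective R K ?_⟩⟩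
      rw [map_mul, map_mul, hw, h]
      ring
    · obtain ⟨w, hw⟩ := (FractionalIdeal.mem_one_iff _).1 (hle (FractionalIdeal.mul_mem_mul haI hj))
      refine ⟨u, hu, .inr ⟨w, FaithfulSMul.algebraMap_injective R K ?_⟩⟩
      rw [map_mul, map_mul, hw, h]
      ring
  exfalso
  obtain ⟨𝔠, h𝔠⟩ := FractionalIdeal.le_one_iff_exists_coeIdeal.1 hle
  have h𝔠fg : 𝔠.FG := by
    refine (IsLocalization.coeSubmodule_fg K (FaithfulSMul.algebraMap_injective R K) 𝔠).1 ?_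
    rw [← FractionalIdeal.coe_coeIdeal (S := R⁰), h𝔠, FractionalIdeal.coe_mul]
    exact hIfg.mul hJfg
  have h𝔠m : 𝔠 ≤ m := by
    have hmul : I * J ≤ (m : FractionalIdeal R⁰ K) := by
      rw [FractionalIdeal.mul_le]
      intro i hi j hj
      obtain ⟨_, hi', rfl⟩ := (FractionalIdeal.mem_coeIdeal _).1 hi
      obtain ⟨r, t, rfl⟩ := Ideal.mem_span_pair.1 hi'
      obtain ⟨u, hu⟩ := (FractionalIdeal.mem_one_iff _).1 (hle (FractionalIdeal.mul_mem_mul haI hj))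
      obtain ⟨w, hw⟩ := (FractionalIdeal.mem_one_iff _).1 (hle (FractionalIdeal.mul_mem_mul hbI hj))
      refine (FractionalIdeal.mem_coeIdeal _).2 ⟨r * u + t * w, ?_, ?_⟩
      · refine add_mem (m.mul_mem_left _ ?_) (m.mul_mem_left _ ?_)
        · exact not_not.1 fun h ↦ hex ⟨j, hj, u, h, .inl hu⟩
        · exact not_not.1 fun h ↦ hex ⟨j, hj, w, h, .inr hw⟩
      · simp only [map_add, map_mul, hu, hw]
        ring
    rwa [← h𝔠, FractionalIdeal.coeIdeal_le_coeIdeal] at hmul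
  obtain ⟨x, hx, hx'⟩ := hm 𝔠 h𝔠fg h𝔠m
  refine hx' ((FractionalIdeal.mem_one_iff _).1 (hone ?_))
  rw [FractionalIdeal.mem_inv_iff hIJ0, ← h𝔠]
  intro y hy
  obtain ⟨j, hj, rfl⟩ := (FractionalIdeal.mem_coeIdeal _).1 hy
  exact (FractionalIdeal.mem_one_iff _).2 (hx j hj)

end IntegerValued

/-! ### Local divisibility versus divisibility in the localization. -/

section LocallyValuative

variable {A : Type*} [CommRing A]

theorem Ideal.isLocallyValuative_of_dvd_total (L : Type*) [CommRing L] [Algebra A L]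
    {p : Ideal A} [p.IsPrime] [IsLocalization.AtPrime L p]
    (h : ∀ a b : L, a ∣ b ∨ b ∣ a) : p.IsLocallyValuative := by
  have key (a b : A) (hab : algebraMap A L a ∣ algebraMap A L b) :
      ∃ s ∉ p, a ∣ s * b := by
    obtain ⟨c, hc⟩ := hab
    obtain ⟨r, t, rfl⟩ := IsLocalization.exists_mk'_eq p.primeCompl c
    have h1 : algebraMap A L (b * t) = algebraMap A L (a * r) := by
      rw [map_mul, hc, mul_assoc, IsLocalization.mk'_spec, map_mul]
    obtain ⟨u, hu⟩ := (IsLocalization.eq_iff_exists p.primeCompl _).1 h1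
    refine ⟨u * t, (u * t).2, u * r, ?_⟩
    linear_combination hu
  intro a b
  rcases h (algebraMap A L a) (algebraMap A L b) with h | h
  · obtain ⟨s, hs, h⟩ := key a b h
    exact ⟨s, hs, .inl h⟩
  · obtain ⟨s, hs, h⟩ := key b a h
    exact ⟨s, hs, .inr h⟩

theorem IsLocalRing.dvd_total_of_isLocallyValuative [IsLocalRing A]
    (h : (IsLocalRing.maximalIdeal A).IsLocallyValuative) (a b : A) : a ∣ b ∨ b ∣ a := by
  obtain ⟨s, hs, h⟩ := h a b
  have hs : IsUnit s := IsLocalRing.notMem_maximalIdeal.1 hs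
  rwa [hs.dvd_mul_left, hs.dvd_mul_left] at h

end LocallyValuative

/-! ### The almost Krull case. -/

section Krull

variable {R K : Type*} [CommRing R] [IsDomain R] [Field K] [Algebra R K] [IsFractionRing R K]

open IsLocalRing in
/-- If the localization of `R` at `m` is a Krull domain, then either it is a valuation ring or
integer-valued polynomials have coefficients in it. -/
theorem IsKrullDomain.isLocallyValuative_or_coeff_mem {m : Ideal R} [m.IsPrime]
    {A : Type*} [CommRing A] [IsDomain A] [Algebra R A] [IsLocalization.AtPrime A m]
    (h : IsKrullDomain A) :
    m.IsLocallyValuative ∨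
      ∀ f ∈ IntegerValuedPolynomials R K, ∀ n, f.coeff n ∈ m.localizationIn K := by
  have := IsLocalization.AtPrime.isLocalRing A m
  have hRA : Function.Injective (algebraMap R A) :=
    IsLocalization.injective A m.primeCompl_le_nonZeroDivisors
  -- In height one, `A` is local and its localization at the maximal ideal is a discrete valuation
  -- ring, so divisibility is total in `A`. The other case includes fields, where the intersection
  -- is over the empty family.
  by_cases hht : (maximalIdeal A).height = 1
  · left
    have := h.isDiscreteValuationRing (maximalIdeal A) hht
    exact Ideal.isLocallyValuative_of_dvd_total A
      (dvd_total_of_isLocallyValuative (Ideal.isLocallyValuative_of_dvd_total _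
        (ValuationRing.dvd_total (R := Localization.AtPrime (maximalIdeal A)))))
  right
  intro f hf n
  obtain ⟨a, b, hb, hab⟩ := IsFractionRing.div_surjective R (f.coeff n)
  have hb0 : b ≠ 0 := nonZeroDivisors.ne_zero hb
  have hbK : algebraMap R K b ≠ 0 := by simpa using hb0
  let ι : R →+* FractionRing A := (algebraMap A (FractionRing A)).comp (algebraMap R A)
  have hι : Function.Injective ι := (IsFractionRing.injective A (FractionRing A)).comp hRA
  have hbι : ι b ≠ 0 := fun h ↦ hb0 (hι (by rw [h, map_zero]))
  have hmem : ι a / ι b ∈ (⊥ : Subalgebra A (FractionRing A)) := by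
    rw [← h.iInf_localization_eq_bot, Algebra.mem_iInf]
    rintro ⟨p', hp'⟩
    let p : Ideal R := p'.asIdeal.comap (algebraMap R A)
    -- Equality would make `p'` the maximal ideal of `A`, which does not have height one. Being
    -- strictly below `m`, `p` has infinite residue ring.
    have hpm : p < m := by
      have hcomap : (maximalIdeal A).comap (algebraMap R A) = m :=
        IsLocalization.AtPrime.under_maximalIdeal A m
      refine lt_of_le_of_ne ?_ fun heq ↦ hht ?_
      · rw [← hcomap]
        exact Ideal.comap_mono (le_maximalIdeal p'.isPrime.ne_top)
      · rw [← hp']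
        congr 1
        rw [← IsLocalization.map_under m.primeCompl A (maximalIdeal A),
          ← IsLocalization.map_under m.primeCompl A p'.asIdeal]
        exact congrArg _ (hcomap.trans heq.symm)
    have := Ideal.infinite_quotient_of_not_isMaximal
      (Ideal.not_isMaximal_of_lt hpm ‹m.IsPrime›.ne_top)
    obtain ⟨s, hs, r, hsr⟩ := Ideal.mem_localizationIn.1
      (IntegerValuedPolynomials.coeff_mem_localizationIn (p := p) hf n)
    have hs0 : s ≠ 0 := fun h ↦ hs (h ▸ p.zero_mem)
    have hsι : ι s ≠ 0 := fun h ↦ hs0 (hι (by rw [h, map_zero]))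
    have hsab : s * a = r * b := by
      apply FaithfulSMul.algebraMap_injective R K
      rw [← hab] at hsr
      rw [map_mul, map_mul, ← hsr]
      field_simp
    refine ⟨algebraMap R A r, algebraMap R A s, hs, ?_⟩
    change ι a / ι b = ι r * (ι s)⁻¹
    rw [← div_eq_mul_inv, div_eq_div_iff hbι hsι, ← map_mul, ← map_mul, mul_comm, hsab]
  obtain ⟨α, hα⟩ := Algebra.mem_bot.1 hmem
  obtain ⟨r, s, rfl⟩ := IsLocalization.exists_mk'_eq m.primeCompl α
  rw [Ideal.mem_localizationIn]
  refine ⟨s, s.2, r, ?_⟩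
  have h1 : IsLocalization.mk' A r s * algebraMap R A b = algebraMap R A a := by
    apply IsFractionRing.injective A (FractionRing A)
    rw [map_mul, hα]
    exact div_mul_cancel₀ _ hbι
  have h2 : r * b = a * s := by
    apply hRA
    rw [map_mul, map_mul, ← h1, ← IsLocalization.mk'_spec A r s]
    ring
  rw [← hab, mul_div_assoc', div_eq_iff hbK, ← map_mul, ← map_mul, h2, mul_comm]

end Krull

/-! ### Comparison of the two Krull dimensions. -/

section Dimension

variable {R K : Type*} [CommRing R] [Field K] [Algebra R K] [IsFractionRing R K]

/-- Evaluation at `0` maps `Int(R)` onto `R` and kills the nonzerodivisor `X`. -/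
theorem IntegerValuedPolynomials.ringKrullDim_add_one_le :
    ringKrullDim R + 1 ≤ ringKrullDim (IntegerValuedPolynomials R K) := by
  let e : IntegerValuedPolynomials R K →+* (algebraMap R K).range :=
    ((Polynomial.evalRingHom (0 : K)).comp (IntegerValuedPolynomials R K).val.toRingHom).codRestrict
      (algebraMap R K).range fun f ↦ by simpa using f.2 0
  let ε : R ≃+* (algebraMap R K).range :=
    RingEquiv.ofBijective (algebraMap R K).rangeRestrict
      ⟨fun a b h ↦ FaithfulSMul.algebraMap_injective R K (congrArg Subtype.val h),
        (algebraMap R K).rangeRestrict_surjective⟩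
  let x : IntegerValuedPolynomials R K := ⟨Polynomial.X, fun r ↦ ⟨r, by simp⟩⟩
  have hx : x ≠ 0 := fun h ↦ Polynomial.X_ne_zero (congrArg Subtype.val h)
  rw [ringKrullDim_eq_of_ringEquiv ε]
  refine ringKrullDim_succ_le_of_surjective e ?_ (mem_nonZeroDivisors_of_ne_zero hx) ?_
  · rintro ⟨_, r, rfl⟩
    exact ⟨algebraMap R _ r, Subtype.ext (by
      simp [e, IsScalarTower.algebraMap_apply R K K[X]])⟩
  · exact Subtype.ext (by simp [e, x])

variable [IsDomain R]

theorem IntegerValuedPolynomials.not_injective_algHom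
    (f : R[X][X] →ₐ[R] IntegerValuedPolynomials R K) : ¬ Function.Injective f := fun hf ↦
  Polynomial.not_injective_algHom_of_field ((IntegerValuedPolynomials R K).val.comp f)
    (Subtype.val_injective.comp hf)

theorem Polynomial.not_injective_algHom (f : R[X][X] →ₐ[R] R[X]) : ¬ Function.Injective f :=
  fun hf ↦ Polynomial.not_injective_algHom_of_field
    ((Polynomial.mapAlgHom (Algebra.ofId R (FractionRing R))).comp f)
    ((Polynomial.map_injective _ (IsFractionRing.injective R (FractionRing R))).comp hf)

variable (R K) in
/-- The inclusion of `R[X]` in the ring of integer-valued polynomials. -/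
noncomputable def Polynomial.toIntegerValuedPolynomials : R[X] →+* IntegerValuedPolynomials R K :=
  (Polynomial.mapRingHom (algebraMap R K)).codRestrict (IntegerValuedPolynomials R K) fun f r ↦
    ⟨f.eval r, by simp [Polynomial.eval_map_algebraMap, Polynomial.aeval_algebraMap_apply]⟩

/-- The alternative may vary with `m`, since each chain is bounded separately, at a maximal ideal
chosen for it. -/
theorem ringKrullDim_integerValuedPolynomials_eq
    (h : ∀ (m : Ideal R) [m.IsMaximal], m.IsLocallyValuative ∨
      ∀ f ∈ IntegerValuedPolynomials R K, ∀ n, f.coeff n ∈ m.localizationIn K) :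
    ringKrullDim (IntegerValuedPolynomials R K) = ringKrullDim R[X] := by
  let φ := Polynomial.toIntegerValuedPolynomials R K
  let := φ.toAlgebra
  have hφ (g : R[X]) : ((algebraMap R[X] (IntegerValuedPolynomials R K) g : _) : K[X]) =
    g.map (algebraMap R K) := rfl
  have : FaithfulSMul R[X] (IntegerValuedPolynomials R K) := by
    rw [faithfulSMul_iff_algebraMap_injective]
    intro f g hfg
    exact Polynomial.map_injective _ (FaithfulSMul.algebraMap_injective R K)
      (congrArg Subtype.val hfg)
  have hfrac {m : Ideal R} [m.IsPrime]
      (hm : ∀ f ∈ IntegerValuedPolynomials R K, ∀ n, f.coeff n ∈ m.localizationIn K)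
      (f : IntegerValuedPolynomials R K) :
      ∃ s ∈ m.primeCompl.map (Polynomial.C : R →+* R[X]), ∃ g,
        algebraMap R[X] (IntegerValuedPolynomials R K) s * f = algebraMap R[X] _ g := by
    obtain ⟨s, hs, g, hg⟩ := Polynomial.exists_smul_eq_map (hm f f.2)
    refine ⟨Polynomial.C s, ⟨s, hs, rfl⟩, g, Subtype.ext ?_⟩
    rw [MulMemClass.coe_mul, hφ, hφ, Polynomial.map_C, hg]
  apply le_antisymm
  · refine iSup_le fun c ↦ ?_
    obtain ⟨m, hm, hcm⟩ := Ideal.exists_le_maximal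
      (c.last.asIdeal.comap (algebraMap R (IntegerValuedPolynomials R K)))
      (Ideal.comap_ne_top _ c.last.isPrime.ne_top)
    rcases h m with hV | hA
    · have : FaithfulSMul R (IntegerValuedPolynomials R K) := by
        rw [faithfulSMul_iff_algebraMap_injective]
        intro a b hab
        exact FaithfulSMul.algebraMap_injective R K[X] (congrArg Subtype.val hab)
      exact (LTSeries.length_le_ringKrullDim_add_one hV
        IntegerValuedPolynomials.not_injective_algHom c hcm).trans
          ringKrullDim_succ_le_ringKrullDim_polynomial
    · refine LTSeries.length_le_of_comap_disjoint (hfrac hA) c ?_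
      rw [Set.disjoint_left]
      rintro _ hs' ⟨s, hs, rfl⟩
      have hC : algebraMap R[X] (IntegerValuedPolynomials R K) (Polynomial.C s) =
          algebraMap R (IntegerValuedPolynomials R K) s :=
        Subtype.ext ((hφ _).trans (Polynomial.map_C _))
      exact hs (hcm (hC ▸ hs' : algebraMap R (IntegerValuedPolynomials R K) s ∈ c.last.asIdeal))
  · refine iSup_le fun c ↦ ?_
    obtain ⟨m, hm, hcm⟩ := Ideal.exists_le_maximal
      (c.last.asIdeal.comap (algebraMap R R[X])) (Ideal.comap_ne_top _ c.last.isPrime.ne_top)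
    rcases h m with hV | hA
    · exact (LTSeries.length_le_ringKrullDim_add_one hV
        Polynomial.not_injective_algHom c hcm).trans
          IntegerValuedPolynomials.ringKrullDim_add_one_le
    · refine LTSeries.length_le_of_fractions (hfrac hA) c ?_
      rw [Set.disjoint_left]
      rintro _ hs' ⟨s, hs, rfl⟩
      exact hs (hcm hs')

end Dimension

theorem mainTheorem2 (R K : Type*) [CommRing R] [IsDomain R] [Field K] [Algebra R K]
    [IsFractionRing R K] (hR : IsPVMD R K ∨ IsAlmostKrullDomain R) :
    ringKrullDim (IntegerValuedPolynomials R K) = ringKrullDim R[X] := by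
  refine ringKrullDim_integerValuedPolynomials_eq fun m _ ↦ ?_
  rcases hR with hR | hR
  · by_cases hm : ∀ J : Ideal R, J.FG → J ≤ m → ∃ x : K,
      (∀ j ∈ J, x * algebraMap R K j ∈ (algebraMap R K).range) ∧ x ∉ (algebraMap R K).range
    · exact .inl (hR.isLocallyValuative hm)
    · push Not at hm
      obtain ⟨J, hJ, hJm, hinv⟩ := hm
      exact .inr fun f hf n ↦
        IntegerValuedPolynomials.coeff_mem_localizationIn_of_inverse_trivial hJ hJm hinv hf n
  · exact (hR m).isLocallyValuative_or_coeff_mem
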